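/- A zero-error channel from $\mathcal X$ to $\mathcal Y$ is a relation $\mathcal W\subseteq\mathcal X\times\mathcal Y$ such that every $x\in\mathcal X$ has a nonempty set $\mathcal W(x)=\{y : (x,y)\in\mathcal W\}$ of possible outputs; we assume that $\mathcal X$ is finite and nonempty. A channel $\mathcal W$ achieves a channel $\mathcal V\subseteq\mathcal X_1\times\mathcal Y_1$, written $\mathcal W\to\mathcal V$, if there are $k\in\mathbb N$, an encoder $e:\mathcal X_1\to\mathcal X^k$ and a decoder $d:\mathcal Y^k\to\mathcal Y_1$ such that $(x,d(y))\in\mathcal V$ for every $x\in\mathcal X_1$ and every output sequence $y\in\mathcal Y^k$ that is possible when the symbols of $e(x)$ are sent in $k$ invocations of $\mathcal W$. For an integer $a\ge 1$, $\mathrm{List}_a$ is the channel with inputs $\{1,\dots,a+1\}$ whose possible outputs on input $x$ are the $a$-element subsets of $\{1,\dots,a+1\}$ that contain $x$; $\mathrm{List}_\infty$ is the trivial channel with one input and one output. The ambiguity $A(\mathcal W)\in\{1,2,\dots\}\cup\{\infty\}$ is the unique $a$ with $\mathcal W\to\mathrm{List}_a$ and $\mathrm{List}_a\to\mathcal W$.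 Let $\mathcal W_1,\dots,\mathcal W_n$ be zero-error channels from $\mathcal X_i$ to $\mathcal Y_i$. In each invocation of their parallel concatenation $\mathcal W_p$ with at most $t$ corrupted channels, the sender inputs one symbol to each $\mathcal W_i$ and the receiver obtains one symbol of each $\mathcal Y_i$; there is a set of at most $t$ channels, the same in all invocations and unknown to sender and receiver, whose outputs are arbitrary, while all other channels work as specified. Its ambiguity is the unique $a$ such that some number of invocations of $\mathcal W_p$ suffices to achieve $\mathrm{List}_a$, and $\mathrm{List}_a$ achieves $k$ invocations of $\mathcal W_p$ for every $k$. **Corollary.** Let none of the channels be corrupted ($t=0$). Then the ambiguities of $\mathcal W_1,\dots,\mathcal W_n$ and of $\mathcal W_p$ are well defined (such an $a$ exists and is unique), and $$A(\mathcal W_p)=\min\bigl(A(\mathcal W_1),\dots,A(\mathcal W_n)\bigr),$$ where the minimum is $\infty$ if $n=0$. -/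

import Mathlib

universe u v

/-- A zero-error channel from `X` to `Y`: a relation that relates every input symbol to at least
one (possible) output symbol. -/
structure ZeroErrorChannel (X : Type u) (Y : Type v) where
  /-- `rel x y`: on input `x`, the output `y` is possible. -/
  rel : X → Y → Prop
  total : ∀ x, ∃ y, rel x y

/-- A communication primitive: for every number `k` of invocations, the channel that says which
sequences of `k` outputs are possible on a sequence of `k` inputs. Successive invocations need
not be independent of each other. -/
abbrev CommPrimitive (X : Type u) (Y : Type v) :=
  ∀ k : ℕ, ZeroErrorChannel (Fin k → X) (Fin k → Y)

/-- An `(X, Y)`-protocol (without feedback) that uses a primitive with input symbols in `X₀` and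
output symbols in `Y₀`: the sender, on input `x`, sends `encode x` in a fixed finite number of
invocations, and the receiver computes its output from the symbols received. -/
structure Protocol (X Y X₀ Y₀ : Type*) where
  invocations : ℕ
  encode : X → Fin invocations → X₀
  decode : (Fin invocations → Y₀) → Y

/-- The protocol, run over the primitive `P`, achieves the channel `V`: for every input and all
possible outputs of the channel invocations, the output of the receiver is valid for `V`. -/
def Protocol.Realizes {X Y X₀ Y₀ : Type*} (π : Protocol X Y X₀ Y₀)
    (P : CommPrimitive X₀ Y₀) (V : ZeroErrorChannel X Y) : Prop :=
  ∀ (x : X) (y : Fin π.invocations → Y₀),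
    (P π.invocations).rel (π.encode x) y → V.rel x (π.decode y)

/-- The channel `V` is achievable from the primitive `P`. -/
def CommPrimitive.Achieves {X₀ Y₀ X Y : Type*} (P : CommPrimitive X₀ Y₀)
    (V : ZeroErrorChannel X Y) : Prop :=
  ∃ π : Protocol X Y X₀ Y₀, π.Realizes P V

namespace ZeroErrorChannel

/-- A channel used as a primitive: any sequence of outputs, each of which is possible for the
input of the same invocation, is possible. -/
def toPrimitive {X Y : Type*} (W : ZeroErrorChannel X Y) : CommPrimitive X Y := fun k =>
  { rel := fun x y => ∀ s : Fin k, W.rel (x s) (y s)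
    total := fun x => ⟨fun s => (W.total (x s)).choose, fun s => (W.total (x s)).choose_spec⟩ }

/-- `W` achieves `V` (written `W → V`). -/
def Achieves {X₀ Y₀ X Y : Type*} (W : ZeroErrorChannel X₀ Y₀) (V : ZeroErrorChannel X Y) : Prop :=
  W.toPrimitive.Achieves V

/-- The list channel with `d` input symbols and lists of length `a`, where `0 < a < d`: the
outputs are the `a`-element sets of input symbols, and those that contain the input symbol are
possible. -/
def listd (a d : ℕ) (ha : 0 < a) (had : a < d) :
    ZeroErrorChannel (Fin d) {y : Finset (Fin d) // y.card = a} where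
  rel x y := x ∈ y.1
  total x := by
    obtain ⟨y, hxy, -, hy⟩ := Finset.exists_subsuperset_card_eq
      (s := {x}) (t := Finset.univ) (n := a) (Finset.subset_univ _)
      (by simpa using Nat.succ_le_of_lt ha) (by simpa using had.le)
    exact ⟨⟨y, hy⟩, hxy (Finset.mem_singleton_self x)⟩

/-- `List_a`, the list channel with `a + 1` input symbols. -/
def list (a : ℕ) (ha : 0 < a) :
    ZeroErrorChannel (Fin (a + 1)) {y : Finset (Fin (a + 1)) // y.card = a} :=
  listd a (a + 1) ha a.lt_succ_self

/-- `List_∞`, the trivial channel, over which no communication is possible. -/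
def listInfty : ZeroErrorChannel Unit Unit where
  rel _ _ := True
  total _ := ⟨(), trivial⟩

/-- `W → List_a` and `List_a → W`, for `a ∈ {1, 2, …} ∪ {∞}`. -/
def IsAmbiguity {X Y : Type*} (W : ZeroErrorChannel X Y) (a : ℕ∞) : Prop :=
  (∃ (n : ℕ) (hn : 0 < n), a = n ∧ W.Achieves (list n hn) ∧ (list n hn).Achieves W) ∨
    (a = ⊤ ∧ W.Achieves listInfty ∧ listInfty.Achieves W)

/-- The ambiguity `A(W)`: the (unique) `a` such that `W → List_a` and `List_a → W`. -/
noncomputable def ambiguity {X Y : Type*} (W : ZeroErrorChannel X Y) : ℕ∞ :=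
  Classical.epsilon fun a => W.IsAmbiguity a

end ZeroErrorChannel

/-- A channel achieves a primitive if it achieves, for every `k`, the channel that consists of
`k` invocations of the primitive. -/
def ZeroErrorChannel.AchievesPrimitive {X₀ Y₀ X Y : Type*} (W : ZeroErrorChannel X₀ Y₀)
    (P : CommPrimitive X Y) : Prop :=
  ∀ k, W.Achieves (P k)

namespace CommPrimitive

/-- `P → List_a` and `List_a → P`, for `a ∈ {1, 2, …} ∪ {∞}`. -/
def IsAmbiguity {X Y : Type*} (P : CommPrimitive X Y) (a : ℕ∞) : Prop :=
  (∃ (n : ℕ) (hn : 0 < n), a = n ∧ P.Achieves (ZeroErrorChannel.list n hn) ∧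
      (ZeroErrorChannel.list n hn).AchievesPrimitive P) ∨
    (a = ⊤ ∧ P.Achieves ZeroErrorChannel.listInfty ∧
      ZeroErrorChannel.listInfty.AchievesPrimitive P)

/-- The ambiguity of a primitive: the (unique) `a` such that `P → List_a` and `List_a → P`. -/
noncomputable def ambiguity {X Y : Type*} (P : CommPrimitive X Y) : ℕ∞ :=
  Classical.epsilon fun a => P.IsAmbiguity a

end CommPrimitive

/-- An honest set structure on the channels with indices in `ι`: the (nonempty) collection of
the possible honest sets, that is, sets of all channels that are not malicious. -/
structure HonestSetStructure (ι : Type*) where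
  sets : Set (Finset ι)
  nonempty : sets.Nonempty

/-- The threshold honest set structure: at most `t` channels are malicious. -/
def HonestSetStructure.threshold (ι : Type*) [Fintype ι] [DecidableEq ι] (t : ℕ) :
    HonestSetStructure ι where
  sets := {h | hᶜ.card ≤ t}
  nonempty := ⟨Finset.univ, by simp⟩

/-- The parallel concatenation of the channels `W i` with the honest set structure `H`. In every
invocation the sender inputs one symbol to each channel and the receiver gets one symbol from each
channel. There is a set `h` in `H`, unknown to the sender and the receiver and the same in all
invocations, such that the channels in `h` work as specified; the outputs of the other channels
are arbitrary. -/
def parallelConcat {ι : Type*} {X : ι → Type*} {Y : ι → Type*}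
    (W : ∀ i, ZeroErrorChannel (X i) (Y i)) (H : HonestSetStructure ι) :
    CommPrimitive (∀ i, X i) (∀ i, Y i) := fun k =>
  { rel := fun x y => ∃ h ∈ H.sets, ∀ i ∈ h, ∀ s : Fin k, (W i).rel (x s i) (y s i)
    total := fun x => by
      obtain ⟨h, hh⟩ := H.nonempty
      exact ⟨fun s i => ((W i).total (x s i)).choose, h, hh,
        fun i _ s => ((W i).total (x s i)).choose_spec⟩ }

/-! The ambiguity is the largest `m` such that any `m` input words share a possible output
(`Confusable`), or `∞` if there is no largest. A protocol preserves this property, and `List_n` has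
it for `n` but not for `n + 1`, which gives one direction of each achievability criterion.
Conversely, `List_n` achieves every finite channel with the property for `n` (`list_achieves_iff`),
and a primitive lacking it for `n + 1` achieves `List_n` (`achieves_list_iff`). So ambiguities are
thresholds of a downward closed property. Without corruption, parallel channels have the property
exactly when each of them does, whence the minimum. -/

namespace ZeroErrorChannel

variable {X Y : Type*}

/-- Any `m` inputs of `V` have a common possible output. -/
def Confusable (V : ZeroErrorChannel X Y) (m : ℕ) : Prop :=
  ∀ f : Fin m → X, ∃ y, ∀ j, V.rel (f j) y

theorem confusable_one (V : ZeroErrorChannel X Y) : V.Confusable 1 := fun f => by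
  obtain ⟨y, hy⟩ := V.total (f 0)
  exact ⟨y, fun j => by rwa [Subsingleton.elim j 0]⟩

theorem Confusable.anti [Nonempty X] {V : ZeroErrorChannel X Y} {m n : ℕ} (hmn : m ≤ n)
    (h : V.Confusable n) : V.Confusable m := fun f => by
  obtain ⟨y, hy⟩ := h fun j => if hj : j.1 < m then f ⟨j, hj⟩ else Classical.arbitrary X
  exact ⟨y, fun j => by simpa using hy (j.castLE hmn)⟩

theorem Confusable.of_achieves {X₀ Y₀ : Type*} {P : CommPrimitive X₀ Y₀}
    {V : ZeroErrorChannel X Y} {m : ℕ} (hP : ∀ k, (P k).Confusable m) (h : P.Achieves V) :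
    V.Confusable m := fun f => by
  obtain ⟨π, hπ⟩ := h
  obtain ⟨y, hy⟩ := hP π.invocations fun j => π.encode (f j)
  exact ⟨π.decode y, fun j => hπ _ _ (hy j)⟩

theorem confusable_toPrimitive {V : ZeroErrorChannel X Y} {m : ℕ} :
    (∀ k, (V.toPrimitive k).Confusable m) ↔ V.Confusable m := by
  constructor
  · intro h f
    obtain ⟨y, hy⟩ := h 1 fun j _ => f j
    exact ⟨y 0, fun j => hy j 0⟩
  · intro h k f
    choose y hy using fun s : Fin k => h fun j => f j s
    exact ⟨y, fun j s => hy s j⟩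

theorem confusable_list (n : ℕ) (hn : 0 < n) : (list n hn).Confusable n := fun f => by
  obtain ⟨y, hy, -, hc⟩ := Finset.exists_subsuperset_card_eq
    (Finset.subset_univ (Finset.univ.image f)) (n := n)
    (Finset.card_image_le.trans (by simp)) (by simp)
  exact ⟨⟨y, hc⟩, fun j => hy (Finset.mem_image_of_mem f (Finset.mem_univ j))⟩

theorem not_confusable_list (n : ℕ) (hn : 0 < n) : ¬ (list n hn).Confusable (n + 1) := fun h => by
  obtain ⟨⟨y, hc⟩, hy⟩ := h id
  have hu : y = Finset.univ := Finset.eq_univ_iff_forall.2 hy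
  simp [hu] at hc

/-- For the converse, send the colour of the input under every colouring with `n + 1` colours. Each
received list excludes one colour. Were `n + 1` inputs still consistent, a colouring separating them
would exclude one of them; so at most `n` survive, and these share an output. -/
theorem list_achieves_iff [Finite X] [Nonempty X] {V : ZeroErrorChannel X Y} {n : ℕ}
    (hn : 0 < n) : (list n hn).Achieves V ↔ V.Confusable n := by
  classical
  refine ⟨Confusable.of_achieves (confusable_toPrimitive.2 (confusable_list n hn)), fun h => ?_⟩
  have := Fintype.ofFinite X
  let e := Fintype.equivFin (X → Fin (n + 1))
  -- The inputs consistent with all received lists.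
  let S (y : Fin (Fintype.card (X → Fin (n + 1))) → {y : Finset (Fin (n + 1)) // y.card = n}) :
      Set X := {x | ∀ f, f x ∈ (y (e f)).1}
  have hS : ∀ y, ∃ z, ∀ x ∈ S y, V.rel x z := by
    intro y
    suffices ∃ f : Fin n → X, S y ⊆ Set.range f by
      obtain ⟨f, hf⟩ := this
      obtain ⟨z, hz⟩ := h f
      refine ⟨z, fun x hx => ?_⟩
      obtain ⟨j, rfl⟩ := hf hx
      exact hz j
    have hcard : Fintype.card (S y) ≤ n := by
      by_contra! hlt
      obtain ⟨g⟩ := Function.Embedding.nonempty_of_card_le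
        (α := Fin (n + 1)) (β := S y) (by simpa using hlt)
      have hg : Function.Injective fun j => (g j : X) := Subtype.val_injective.comp g.injective
      have hu : (y (e (Function.invFun fun j => (g j : X)))).1 = Finset.univ :=
        Finset.eq_univ_iff_forall.2 fun j => by
          simpa [Function.leftInverse_invFun hg j] using
            (g j).2 (Function.invFun fun j => (g j : X))
      have hc := (y (e (Function.invFun fun j => (g j : X)))).2
      simp [hu] at hc
    obtain ⟨g⟩ := Function.Embedding.nonempty_of_card_le
      (α := S y) (β := Fin n) (by simpa using hcard)
    -- Fewer than `n` inputs may survive; the default value pads the family.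
    refine ⟨Function.extend g Subtype.val fun _ => Classical.arbitrary X, fun x hx => ?_⟩
    exact ⟨g ⟨x, hx⟩, g.injective.extend_apply _ _ _⟩
  choose d hd using hS
  refine ⟨⟨_, fun x s => e.symm s x, d⟩, fun x y hxy => hd y x fun f => ?_⟩
  have hf : (list n hn).rel (f x) (y (e f)) := by simpa using hxy (e f)
  exact hf

theorem listInfty_achieves_iff [Finite X] [Nonempty X] {V : ZeroErrorChannel X Y} :
    listInfty.Achieves V ↔ ∀ m, V.Confusable m := by
  constructor
  · exact fun h m => Confusable.of_achieves
      (confusable_toPrimitive.2 fun _ => ⟨(), fun _ => trivial⟩) h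
  · intro h
    -- With `m = |X|`, one output is valid for all inputs, so nothing need be sent.
    obtain ⟨m, ⟨e⟩⟩ := Finite.exists_equiv_fin X
    obtain ⟨y, hy⟩ := h m e.symm
    exact ⟨⟨0, fun _ _ => (), fun _ => y⟩, fun x _ _ => by simpa using hy (e x)⟩

end ZeroErrorChannel

namespace CommPrimitive

open ZeroErrorChannel

variable {X Y : Type*}

theorem achieves_listInfty (P : CommPrimitive X Y) : P.Achieves listInfty :=
  ⟨⟨0, fun _ => Fin.elim0, fun _ => ()⟩, fun _ _ _ => trivial⟩

/-- If `n + 1` words have no common output, every received `y` rules out some word `g y`, and the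
decoder lists the other `n` indices. -/
theorem achieves_list_iff {P : CommPrimitive X Y} {n : ℕ} (hn : 0 < n) :
    P.Achieves (list n hn) ↔ ¬ ∀ k, (P k).Confusable (n + 1) := by
  refine ⟨fun h hP => not_confusable_list n hn (Confusable.of_achieves hP h), fun h => ?_⟩
  simp only [Confusable, not_forall, not_exists] at h
  obtain ⟨k, f, hf⟩ := h
  choose g hg using hf
  refine ⟨⟨k, f, fun y => ⟨Finset.univ.erase (g y), by simp⟩⟩, fun j y hy => ?_⟩
  refine Finset.mem_erase.2 ⟨?_, Finset.mem_univ _⟩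
  rintro rfl
  exact hg y hy

end CommPrimitive

/-- A threshold `a ∈ {1, 2, …} ∪ {∞}` of a downward closed property of natural numbers. -/
theorem ENat.isThreshold_iff {p : ℕ → Prop} (h_one : p 1) (hp : ∀ m n, m ≤ n → p n → p m)
    (a : ℕ∞) : ((∃ n : ℕ, 0 < n ∧ a = n ∧ ¬ p (n + 1) ∧ p n) ∨ (a = ⊤ ∧ ∀ m, p m)) ↔
      ∀ m : ℕ, p m ↔ (m : ℕ∞) ≤ a := by
  constructor
  · rintro (⟨n, -, rfl, h, h'⟩ | ⟨rfl, h⟩) m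
    · rw [Nat.cast_le]
      exact ⟨fun hm => not_lt.1 fun hlt => h (hp _ _ hlt hm), fun hm => hp _ _ hm h'⟩
    · simp [h]
  · intro h
    induction a using ENat.recTopCoe with
    | top => exact Or.inr ⟨rfl, fun m => (h m).2 le_top⟩
    | coe n =>
      simp only [Nat.cast_le] at h
      exact Or.inl ⟨n, (h 1).1 h_one, rfl, fun h' => by have := (h _).1 h'; omega,
        (h n).2 le_rfl⟩

theorem ENat.existsUnique_threshold {p : ℕ → Prop} (h_one : p 1)
    (hp : ∀ m n, m ≤ n → p n → p m) : ∃! a : ℕ∞, ∀ m : ℕ, p m ↔ (m : ℕ∞) ≤ a := by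
  classical
  refine existsUnique_of_exists_of_unique ?_ fun a b ha hb =>
    ENat.eq_of_forall_natCast_le_iff fun m => (ha m).symm.trans (hb m)
  by_cases h : ∀ m, p m
  · exact ⟨⊤, by simp [h]⟩
  · push Not at h
    -- `p 0` follows from `p 1`, so the first failure has a predecessor, which is the threshold.
    have hpos : Nat.find h ≠ 0 := fun h0 =>
      Nat.find_spec h (hp _ 1 (by omega) h_one)
    obtain ⟨n, hn⟩ := Nat.exists_eq_succ_of_ne_zero hpos
    refine ⟨n, fun m => ?_⟩
    rw [Nat.cast_le]
    constructor
    · intro hm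
      by_contra! hlt
      exact Nat.find_spec h (hp _ _ (by omega) hm)
    · intro hm
      exact not_not.1 (Nat.find_min h (by omega))

namespace CommPrimitive

open ZeroErrorChannel

variable {X Y : Type*} [Finite X] [Nonempty X]

theorem isAmbiguity_iff {P : CommPrimitive X Y} {a : ℕ∞} :
    P.IsAmbiguity a ↔ ∀ m : ℕ, (∀ k, (P k).Confusable m) ↔ (m : ℕ∞) ≤ a := by
  rw [← ENat.isThreshold_iff (fun k => (P k).confusable_one)
    fun m n hmn h k => (h k).anti hmn]
  simp only [IsAmbiguity, AchievesPrimitive, list_achieves_iff, listInfty_achieves_iff,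
    achieves_list_iff, achieves_listInfty, true_and, exists_prop]
  rw [forall_comm]

theorem existsUnique_isAmbiguity (P : CommPrimitive X Y) : ∃! a : ℕ∞, P.IsAmbiguity a := by
  simp only [isAmbiguity_iff]
  exact ENat.existsUnique_threshold (fun k => (P k).confusable_one)
    fun m n hmn h k => (h k).anti hmn

theorem natCast_le_ambiguity_iff {P : CommPrimitive X Y} {m : ℕ} :
    (m : ℕ∞) ≤ P.ambiguity ↔ ∀ k, (P k).Confusable m :=
  (isAmbiguity_iff.1 (Classical.epsilon_spec P.existsUnique_isAmbiguity.exists) m).symm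

end CommPrimitive

namespace ZeroErrorChannel

variable {X Y : Type*} [Finite X] [Nonempty X]

theorem isAmbiguity_toPrimitive {V : ZeroErrorChannel X Y} {a : ℕ∞} :
    V.toPrimitive.IsAmbiguity a ↔ V.IsAmbiguity a := by
  simp only [CommPrimitive.IsAmbiguity, IsAmbiguity, AchievesPrimitive, list_achieves_iff,
    listInfty_achieves_iff, confusable_toPrimitive]
  rw [forall_comm]
  simp only [confusable_toPrimitive, Achieves]

theorem ambiguity_toPrimitive (V : ZeroErrorChannel X Y) :
    V.toPrimitive.ambiguity = V.ambiguity := by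
  simp only [CommPrimitive.ambiguity, ambiguity, isAmbiguity_toPrimitive]

end ZeroErrorChannel

theorem confusable_parallelConcat {ι : Type*} [Fintype ι] [DecidableEq ι] {X Y : ι → Type*}
    [∀ i, Nonempty (X i)] {W : ∀ i, ZeroErrorChannel (X i) (Y i)} {m : ℕ} :
    (∀ k, (parallelConcat W (HonestSetStructure.threshold ι 0) k).Confusable m) ↔
      ∀ i, (W i).Confusable m := by
  constructor
  · intro h i f
    -- One invocation suffices, with the same fixed symbols on all channels other than `i`.
    obtain ⟨y, hy⟩ := h 1 fun j _ => Function.update (fun _ => Classical.arbitrary _) i (f j)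
    refine ⟨y 0 i, fun j => ?_⟩
    obtain ⟨s, hs, hsy⟩ := hy j
    have hs' : s = Finset.univ := by simpa [HonestSetStructure.threshold] using hs
    simpa using hsy i (by simp [hs']) 0
  · intro h k f
    -- Common outputs are chosen separately for each channel and invocation.
    choose y hy using fun (s : Fin k) i => h i fun j => f j s i
    exact ⟨y, fun j => ⟨Finset.univ, by simp [HonestSetStructure.threshold],
      fun i _ s => hy s i j⟩⟩

/-- The ambiguities of the channels and of their parallel concatenation with `t = 0` malicious
channels are well defined, and the latter is the minimum of the former (`∞` if `n = 0`). -/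
theorem mainTheorem8 (n : ℕ) (X : Fin n → Type u) (Y : Fin n → Type v)
    [∀ i, Finite (X i)] [∀ i, Nonempty (X i)]
    (W : ∀ i, ZeroErrorChannel (X i) (Y i)) :
    (∀ i, ∃! a : ℕ∞, (W i).IsAmbiguity a) ∧
    (∃! a : ℕ∞, (parallelConcat W (HonestSetStructure.threshold (Fin n) 0)).IsAmbiguity a) ∧
    (parallelConcat W (HonestSetStructure.threshold (Fin n) 0)).ambiguity =
      ⨅ i, (W i).ambiguity := by
  refine ⟨fun i => ?_, CommPrimitive.existsUnique_isAmbiguity _,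
    ENat.eq_of_forall_natCast_le_iff fun m => ?_⟩
  · simpa only [ZeroErrorChannel.isAmbiguity_toPrimitive] using
      (W i).toPrimitive.existsUnique_isAmbiguity
  · simp only [le_iInf_iff, ← ZeroErrorChannel.ambiguity_toPrimitive,
      CommPrimitive.natCast_le_ambiguity_iff, ZeroErrorChannel.confusable_toPrimitive,
      confusable_parallelConcat]
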